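/- Let $0\le k\le n$ and let $\Delta^n=\{x\in\mathbb R^{n+1}: x_0,\dots,x_n\ge 0,\ x_0+\dots+x_n=1\}$ be the standard $n$-simplex. A $k$-face of $\Delta^n$ is the convex hull of $k+1$ of its vertices, and a facet is the convex hull of all its vertices but one. Let $X_1,\dots,X_N\subseteq\Delta^n$ be closed sets such that each $X_i$ is disjoint from at least one facet of $\Delta^n$ (the facet may depend on $i$). Suppose that no $k+1$ of the sets have a common point, that is, $\bigcap_{i\in I}X_i=\emptyset$ for every $I\subseteq\{1,\dots,N\}$ with $|I|=k+1$. Then there is a connected component of $\Delta^n\setminus\bigcup_{i=1}^N X_i$ that intersects every $k$-face of $\Delta^n$. -/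

import Mathlib

/-- The face of the standard simplex `Δⁿ ⊆ ℝⁿ⁺¹` spanned by the vertices `e_j`, `j ∈ s`:
the points of `Δⁿ` whose barycentric coordinates vanish outside `s`. -/
def simplexFace {n : ℕ} (s : Finset (Fin (n + 1))) : Set (Fin (n + 1) → ℝ) :=
  {x | x ∈ stdSimplex ℝ (Fin (n + 1)) ∧ ∀ j, j ∉ s → x j = 0}

/-- `F` is a `k`-face of `Δⁿ`: a face spanned by `k + 1` vertices. -/
def IsSimplexFace (n k : ℕ) (F : Set (Fin (n + 1) → ℝ)) : Prop :=
  ∃ s : Finset (Fin (n + 1)), s.card = k + 1 ∧ F = simplexFace s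

/-- `F` is a facet of `Δⁿ`: a face spanned by all vertices but one. -/
def IsSimplexFacet (n : ℕ) (F : Set (Fin (n + 1) → ℝ)) : Prop :=
  ∃ j : Fin (n + 1), F = simplexFace {j}ᶜ

/-! Triangulate the faces of the simplex finely and compatibly. A vertex lying near some `X i` is
labelled by the vertex opposite a facet that `X i` misses, any other vertex by its component of the
complement. At fine mesh, a vertex label over a face `F` belongs to `F`, a simplex carries at most
`k` distinct vertex labels because the sets behind them share a point, and it carries at most one
component because its edges are short. This is `IsLabelledChain`.

The rest is a mod 2 count, `IsLabelledChain.exists_label`. Let `u F` count the simplices over `F`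
labelled exactly by `F`, and `e j a F` those labelled by `F.erase a` and the component `j`.
Comparing boundary coefficients gives `u F + ∑ j, e j a F = u (F.erase a)`, and shows that each `e
j` is closed around squares of faces. Hence `e j` is the differential of a potential `φ j` with `φ j
∅ = 0`, and `∑ j, φ j F = u F + 1`. If `F` has `k + 1` vertices then `u F = 0`, so some `φ j F` is
nonzero. As `e j` vanishes on sets of size `k + 2`, `φ j` is constant on sets of size `k + 1`. Thus
this one `j` occurs over every `k`-face. -/

open MvPolynomial in
/-- The boundary operator on mod 2 chains: a simplex is a squarefree monomial in its vertices, and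
the boundary is the derivation that sends every variable to `1`. -/
noncomputable def chainBoundary (σ : Type*) :
    Derivation (ZMod 2) (MvPolynomial σ (ZMod 2)) (MvPolynomial σ (ZMod 2)) :=
  mkDerivation (ZMod 2) fun _ => 1

/-! ### Mod 2 chains as polynomials. -/

section Boundary

open MvPolynomial

variable {σ τ : Type*}

@[simp]
theorem chainBoundary_X (v : σ) : chainBoundary σ (X v) = 1 := by
  simp [chainBoundary, mkDerivation_X]

theorem chainBoundary_X_mul (v : σ) (p : MvPolynomial σ (ZMod 2)) :
    chainBoundary σ (X v * p) = p + X v * chainBoundary σ p := by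
  simp [Derivation.leibniz, add_comm]

theorem chainBoundary_monomial (m : σ →₀ ℕ) :
    chainBoundary σ (monomial m 1) =
      ∑ v ∈ m.support, (m v : ZMod 2) • monomial (m - Finsupp.single v 1) 1 := by
  simp [chainBoundary, mkDerivation_monomial, Finsupp.sum, smul_monomial]

theorem chainBoundary_rename (f : σ → τ) (p : MvPolynomial σ (ZMod 2)) :
    chainBoundary τ (rename f p) = rename f (chainBoundary σ p) := by
  induction p using MvPolynomial.induction_on with
  | C a => simp [derivation_C]
  | add p q hp hq => simp [hp, hq]
  | mul_X p v hp => simp [Derivation.leibniz, hp]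

theorem chainBoundary_chainBoundary (p : MvPolynomial σ (ZMod 2)) :
    chainBoundary σ (chainBoundary σ p) = 0 := by
  induction p using MvPolynomial.induction_on with
  | C a => simp [derivation_C]
  | add p q hp hq => simp [hp, hq]
  | mul_X p v hp =>
    rw [mul_comm, chainBoundary_X_mul, map_add, chainBoundary_X_mul, hp, mul_zero, add_zero]
    exact CharTwo.add_self_eq_zero _

theorem chainBoundary_prod_X {ι : Type*} [DecidableEq ι] (f : ι → σ) (s : Finset ι) :
    chainBoundary σ (∏ a ∈ s, X (f a)) = ∑ a ∈ s, ∏ b ∈ s.erase a, X (f b) := by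
  induction s using Finset.induction_on with
  | empty => simp
  | insert a s ha ih =>
    rw [Finset.prod_insert ha, chainBoundary_X_mul, ih, Finset.sum_insert ha,
      Finset.erase_insert ha, Finset.mul_sum]
    congr 1
    refine Finset.sum_congr rfl fun b hb => ?_
    have hab : a ≠ b := fun h => ha (h ▸ hb)
    rw [Finset.erase_insert_of_ne hab, Finset.prod_insert (by simp [ha])]

/-- The coefficients of a boundary. -/
theorem coeff_chainBoundary (p : MvPolynomial σ (ZMod 2)) (S : Finset σ)
    (hS : ∀ m ∈ p.support, m.support ⊆ S) (t : σ →₀ ℕ) :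
    coeff t (chainBoundary σ p) =
      ∑ x ∈ S, coeff (t + Finsupp.single x 1) p * ((t x : ZMod 2) + 1) := by
  classical
  have hsum : ∀ q : MvPolynomial σ (ZMod 2), (∑ x ∈ S, pderiv x) q = ∑ x ∈ S, pderiv x q := by
    intro q
    have := congrFun (map_sum (Derivation.coeFnAddMonoidHom (R := ZMod 2)
      (A := MvPolynomial σ (ZMod 2)) (M := MvPolynomial σ (ZMod 2))) pderiv S) q
    rw [Finset.sum_apply] at this
    exact this
  have h : chainBoundary σ p = (∑ x ∈ S, pderiv x) p := by
    refine derivation_eq_of_forall_mem_vars fun i hi => ?_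
    obtain ⟨m, hm, him⟩ := (mem_vars_iff_mem_support i).1 hi
    have : i ∈ S := hS m hm him
    simp [hsum, pderiv_X, Pi.single_apply, this]
  rw [h, hsum, coeff_sum]
  refine Finset.sum_congr rfl fun x _ => ?_
  rw [coeff_pderiv]

end Boundary

/-! ### Barycentric subdivision of chains. -/

section Subdivision

open MvPolynomial

variable {V : Type*} [NormedAddCommGroup V] [NormedSpace ℝ V]

/-- The barycenter of a finite multiset of points. -/
noncomputable def barycenter (m : V →₀ ℕ) : V :=
  m.support.centerMass (fun v => (m v : ℝ)) id

/-- The barycentric subdivision of a simplex. -/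
noncomputable def subdivideSimplex (m : V →₀ ℕ) : MvPolynomial V (ZMod 2) :=
  open Classical in
  if m = 0 then 1 else
    X (barycenter m) *
      ∑ v ∈ m.support.attach, (m v : ZMod 2) • subdivideSimplex (m - Finsupp.single v.1 1)
termination_by m.degree
decreasing_by
  have hv : m v.1 ≠ 0 := Finsupp.mem_support_iff.1 v.2
  have h : m - Finsupp.single v.1 1 + Finsupp.single v.1 1 = m :=
    tsub_add_cancel_of_le (by simpa using Nat.one_le_iff_ne_zero.2 hv)
  have := congrArg Finsupp.degree h
  rw [map_add, Finsupp.degree_single] at this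
  omega

/-- Barycentric subdivision of chains. -/
noncomputable def subdivide : MvPolynomial V (ZMod 2) →ₗ[ZMod 2] MvPolynomial V (ZMod 2) :=
  (basisMonomials V (ZMod 2)).constr (ZMod 2) subdivideSimplex

theorem subdivide_monomial (m : V →₀ ℕ) : subdivide (monomial m 1) = subdivideSimplex m := by
  have := (basisMonomials V (ZMod 2)).constr_basis (ZMod 2) (subdivideSimplex (V := V)) m
  rwa [coe_basisMonomials] at this

theorem subdivide_one : subdivide (1 : MvPolynomial V (ZMod 2)) = 1 := by
  have := subdivide_monomial (0 : V →₀ ℕ)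
  rw [subdivideSimplex, if_pos rfl] at this
  simpa using this

theorem degree_sub_single_add_one {σ : Type*} {m : σ →₀ ℕ} {v : σ} (hv : v ∈ m.support) :
    (m - Finsupp.single v 1).degree + 1 = m.degree := by
  have h : m - Finsupp.single v 1 + Finsupp.single v 1 = m :=
    tsub_add_cancel_of_le (by simpa using Nat.one_le_iff_ne_zero.2 (Finsupp.mem_support_iff.1 hv))
  simpa using congrArg Finsupp.degree h

/-- The cone formula: multiplying by a variable is coning from that point. -/
theorem subdivide_monomial_of_ne_zero {m : V →₀ ℕ} (hm : m ≠ 0) :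
    subdivide (monomial m 1) =
      X (barycenter m) * subdivide (chainBoundary V (monomial m 1)) := by
  rw [subdivide_monomial, subdivideSimplex, if_neg hm, chainBoundary_monomial, map_sum]
  congr 1
  rw [Finset.sum_attach m.support
    (fun v => (m v : ZMod 2) • subdivideSimplex (m - Finsupp.single v 1))]
  simp [subdivide_monomial]

/-- By induction on the degree: the boundary of a cone is its base plus the cone over the boundary
of the base, and here the base is a cycle since the boundary squares to zero. -/
theorem chainBoundary_subdivide (p : MvPolynomial V (ZMod 2)) :
    chainBoundary V (subdivide p) = subdivide (chainBoundary V p) := by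
  have key : ∀ d : ℕ, ∀ m : V →₀ ℕ, m.degree = d →
      chainBoundary V (subdivide (monomial m 1)) = subdivide (chainBoundary V (monomial m 1)) := by
    intro d
    induction d with
    | zero =>
      intro m hm
      obtain rfl := (Finsupp.degree_eq_zero_iff m).1 hm
      have h1 : (monomial (0 : V →₀ ℕ) (1 : ZMod 2)) = 1 := rfl
      simp [h1, subdivide_one]
    | succ d ih =>
      intro m hm
      have hm0 : m ≠ 0 := by rintro rfl; simp at hm
      have h2 : chainBoundary V (subdivide (chainBoundary V (monomial m 1))) = 0 := by
        have : chainBoundary V (subdivide (chainBoundary V (monomial m 1))) =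
            subdivide (chainBoundary V (chainBoundary V (monomial m 1))) := by
          rw [chainBoundary_monomial]
          simp only [map_sum, map_smul, Derivation.map_smul]
          refine Finset.sum_congr rfl fun v hv => ?_
          rw [ih _ (by have := degree_sub_single_add_one hv; omega)]
        rw [this, chainBoundary_chainBoundary, map_zero]
      rw [subdivide_monomial_of_ne_zero hm0, chainBoundary_X_mul, h2, mul_zero, add_zero]
  induction p using MvPolynomial.induction_on' with
  | monomial m a =>
    have : monomial m a = a • monomial m (1 : ZMod 2) := by simp [smul_monomial]
    rw [this]
    simp only [map_smul, Derivation.map_smul, key _ m rfl]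
  | add p q hp hq => simp [hp, hq]

theorem barycenter_mem_convexHull {m : V →₀ ℕ} (hm : m ≠ 0) :
    barycenter m ∈ convexHull ℝ (m.support : Set V) := by
  refine Finset.centerMass_mem_convexHull _ (fun _ _ => by positivity) ?_ (fun i hi => hi)
  obtain ⟨v, hv⟩ := Finsupp.support_nonempty_iff.2 hm
  refine Finset.sum_pos' (fun _ _ => by positivity) ⟨v, hv, ?_⟩
  exact_mod_cast Nat.pos_of_ne_zero (Finsupp.mem_support_iff.1 hv)

/-- The vertex `s` itself has weight at least `1 / m.degree` in the barycenter and contributes no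
distance. -/
theorem dist_barycenter_le {m : V →₀ ℕ} {ρ : ℝ} {s : V} (hs : s ∈ m.support)
    (hρ : ∀ v ∈ m.support, dist v s ≤ ρ) {N : ℕ} (hN : m.degree ≤ N) :
    dist s (barycenter m) ≤ (1 - 1 / (N : ℝ)) * ρ := by
  have hρ0 : 0 ≤ ρ := dist_nonneg.trans (hρ s hs)
  have hms : 1 ≤ m s := Nat.one_le_iff_ne_zero.2 (Finsupp.mem_support_iff.1 hs)
  have hd : m s ≤ m.degree := Finsupp.le_degree s m
  have hd0 : (0 : ℝ) < m.degree := by exact_mod_cast (by omega : 0 < m.degree)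
  have hsum : ∑ v ∈ m.support, (m v : ℝ) = m.degree := by
    rw [Finsupp.degree_apply]; push_cast; rfl
  have h1 : barycenter m - s = (m.degree : ℝ)⁻¹ • ∑ v ∈ m.support, (m v : ℝ) • (v - s) := by
    simp only [smul_sub, Finset.sum_sub_distrib, ← Finset.sum_smul, hsum]
    rw [barycenter, Finset.centerMass, hsum, smul_smul, inv_mul_cancel₀ hd0.ne', one_smul]
    rfl
  have h2 : ‖∑ v ∈ m.support, (m v : ℝ) • (v - s)‖ ≤ ((m.degree : ℝ) - 1) * ρ := by
    classical
    rw [← Finset.add_sum_erase _ _ hs, sub_self, smul_zero, zero_add]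
    calc ‖∑ v ∈ m.support.erase s, (m v : ℝ) • (v - s)‖
        ≤ ∑ v ∈ m.support.erase s, (m v : ℝ) * ρ := by
          refine norm_sum_le_of_le _ fun v hv => ?_
          rw [norm_smul, ← dist_eq_norm, Real.norm_of_nonneg (by positivity)]
          exact mul_le_mul_of_nonneg_left (hρ v (Finset.mem_of_mem_erase hv)) (by positivity)
      _ = ((m.degree : ℝ) - m s) * ρ := by
          rw [← Finset.sum_mul, ← hsum, ← Finset.add_sum_erase _ _ hs, add_sub_cancel_left]
      _ ≤ ((m.degree : ℝ) - 1) * ρ := by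
          have : (1 : ℝ) ≤ m s := by exact_mod_cast hms
          gcongr
  have hNd : (m.degree : ℝ) ≤ N := by exact_mod_cast hN
  rw [dist_comm, dist_eq_norm, h1, norm_smul, Real.norm_of_nonneg (by positivity)]
  calc (m.degree : ℝ)⁻¹ * ‖∑ v ∈ m.support, (m v : ℝ) • (v - s)‖
      ≤ (m.degree : ℝ)⁻¹ * (((m.degree : ℝ) - 1) * ρ) := by gcongr
    _ = (1 - 1 / (m.degree : ℝ)) * ρ := by field_simp
    _ ≤ (1 - 1 / (N : ℝ)) * ρ := by gcongr

/-- Barycentric subdivision keeps the degree, stays in the convex hull and shrinks the mesh. -/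
theorem mem_support_subdivide_monomial (N : ℕ) {ρ : ℝ} (m : V →₀ ℕ) (hN : m.degree ≤ N)
    (hρ : ∀ v ∈ m.support, ∀ w ∈ m.support, dist v w ≤ ρ) :
    ∀ m' ∈ (subdivide (monomial m 1)).support,
      m'.degree = m.degree ∧ (∀ v ∈ m'.support, v ∈ convexHull ℝ (m.support : Set V)) ∧
        ∀ v ∈ m'.support, ∀ w ∈ m'.support, dist v w ≤ (1 - 1 / (N : ℝ)) * ρ := by
  classical
  obtain ⟨d, hd⟩ : ∃ d, m.degree = d := ⟨_, rfl⟩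
  induction d generalizing m with
  | zero =>
    obtain rfl := (Finsupp.degree_eq_zero_iff m).1 hd
    intro m' hm'
    have h1 : (monomial (0 : V →₀ ℕ) (1 : ZMod 2)) = 1 := rfl
    rw [h1, subdivide_one, ← h1] at hm'
    obtain rfl : m' = 0 := by
      have := support_monomial_subset hm'
      simpa using this
    simp
  | succ d ih =>
    intro m' hm'
    have hm0 : m ≠ 0 := by rintro rfl; simp at hd
    rw [subdivide_monomial_of_ne_zero hm0, support_X_mul, Finset.mem_map] at hm'
    obtain ⟨m'', hm'', rfl⟩ := hm'
    rw [addLeftEmbedding_apply]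
    rw [chainBoundary_monomial, map_sum] at hm''
    obtain ⟨v, hv, hvm⟩ := Finset.mem_biUnion.1 (support_sum hm'')
    rw [map_smul] at hvm
    have hvm' := support_smul hvm
    have hdeg := degree_sub_single_add_one hv
    have hsub : (m - Finsupp.single v 1).support ⊆ m.support :=
      Finsupp.support_mono tsub_le_self
    obtain ⟨h1, h2, h3⟩ := ih (m - Finsupp.single v 1) (by omega)
      (fun a ha b hb => hρ a (hsub ha) b (hsub hb)) (by omega) m'' hvm'
    have hb := barycenter_mem_convexHull hm0
    have h2' : ∀ a ∈ m''.support, a ∈ convexHull ℝ (m.support : Set V) := fun a ha =>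
      convexHull_mono (by exact_mod_cast hsub) (h2 a ha)
    -- The ball contains the vertices of `m` and is convex, so it contains every vertex of the
    -- subdivision.
    have hball : convexHull ℝ (m.support : Set V) ⊆
        Metric.closedBall (barycenter m) ((1 - 1 / (N : ℝ)) * ρ) :=
      convexHull_min (fun s hs => dist_barycenter_le hs (fun a ha => hρ a ha s hs) hN)
        (convex_closedBall _ _)
    have hmem : ∀ a ∈ (Finsupp.single (barycenter m) 1 + m'').support,
        a = barycenter m ∨ a ∈ m''.support := by
      intro a ha
      rcases Finset.mem_union.1 (Finsupp.support_add ha) with h | h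
      · exact Or.inl (by simpa using Finsupp.support_single_subset h)
      · exact Or.inr h
    refine ⟨?_, ?_, ?_⟩
    · rw [map_add, Finsupp.degree_single]; omega
    · intro a ha
      rcases hmem a ha with rfl | h
      · exact hb
      · exact h2' a h
    · intro a ha b hb'
      rcases hmem a ha with rfl | h <;> rcases hmem b hb' with rfl | h'
      · exact hball hb
      · rw [dist_comm]; exact hball (h2' b h')
      · exact hball (h2' a h)
      · exact h3 a h b h'

theorem mem_support_subdivide {p : MvPolynomial V (ZMod 2)} {m' : V →₀ ℕ}
    (hm' : m' ∈ (subdivide p).support) :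
    ∃ m ∈ p.support, m' ∈ (subdivide (monomial m 1)).support := by
  classical
  rw [p.as_sum, map_sum] at hm'
  obtain ⟨m, hm, h⟩ := Finset.mem_biUnion.1 (support_sum hm')
  refine ⟨m, hm, ?_⟩
  have : monomial m (coeff m p) = coeff m p • monomial m (1 : ZMod 2) := by simp [smul_monomial]
  rw [this, map_smul] at h
  exact support_smul h

end Subdivision

/-! ### Fine compatible chains on the faces. -/

section FineChains

open MvPolynomial

theorem convex_simplexFace {n : ℕ} (s : Finset (Fin (n + 1))) : Convex ℝ (simplexFace s) := by
  intro x hx y hy a b ha hb hab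
  refine ⟨convex_stdSimplex ℝ _ hx.1 hy.1 ha hb hab, fun j hj => ?_⟩
  simp [hx.2 j hj, hy.2 j hj]

/-- The faces of the standard simplex have arbitrarily fine compatible mod 2 triangulations. -/
theorem exists_fine_chains (n : ℕ) {ε : ℝ} (hε : 0 < ε) :
    ∃ c : Finset (Fin (n + 1)) → MvPolynomial (Fin (n + 1) → ℝ) (ZMod 2),
      c ∅ = 1 ∧
      (∀ F, chainBoundary _ (c F) = ∑ a ∈ F, c (F.erase a)) ∧
      ∀ F, ∀ m ∈ (c F).support, m.degree = F.card ∧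
        (∀ v ∈ m.support, v ∈ simplexFace F) ∧
        ∀ v ∈ m.support, ∀ w ∈ m.support, dist v w ≤ ε := by
  classical
  set κ : ℝ := 1 - 1 / ((n + 1 : ℕ) : ℝ) with hκ
  have hκ0 : 0 ≤ κ := by
    rw [hκ, sub_nonneg, div_le_one (by positivity)]
    exact_mod_cast Nat.succ_pos n
  have hκ1 : κ < 1 := by
    rw [hκ]
    have : (0 : ℝ) < 1 / ((n + 1 : ℕ) : ℝ) := by positivity
    linarith
  have step : ∀ r : ℕ, ∃ c : Finset (Fin (n + 1)) → MvPolynomial (Fin (n + 1) → ℝ) (ZMod 2),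
      c ∅ = 1 ∧
      (∀ F, chainBoundary _ (c F) = ∑ a ∈ F, c (F.erase a)) ∧
      ∀ F, ∀ m ∈ (c F).support, m.degree = F.card ∧
        (∀ v ∈ m.support, v ∈ simplexFace F) ∧
        ∀ v ∈ m.support, ∀ w ∈ m.support, dist v w ≤ κ ^ r := by
    intro r
    induction r with
    | zero =>
      refine ⟨fun F => ∏ a ∈ F, X (Pi.single a 1), by simp,
        fun F => chainBoundary_prod_X _ F, fun F m hm => ?_⟩
      have hprod : ∏ a ∈ F, X (Pi.single a 1) = monomial
          (∑ a ∈ F, Finsupp.single (Pi.single a (1 : ℝ) : Fin (n + 1) → ℝ) 1) (1 : ZMod 2) := by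
        rw [monomial_sum_one]; rfl
      simp only [hprod] at hm
      obtain rfl := Finset.mem_singleton.1 (support_monomial_subset hm)
      have hface : ∀ v ∈ (∑ a ∈ F, Finsupp.single
          (Pi.single a (1 : ℝ) : Fin (n + 1) → ℝ) 1).support, v ∈ simplexFace F := by
        intro v hv
        obtain ⟨a, ha, hav⟩ := Finset.mem_biUnion.1 (Finsupp.support_finsetSum hv)
        obtain rfl : v = Pi.single a 1 := by simpa using Finsupp.support_single_subset hav
        refine ⟨single_mem_stdSimplex ℝ a, fun j hj => ?_⟩
        exact Pi.single_eq_of_ne (fun h : j = a => hj (h ▸ ha)) 1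
      refine ⟨by simp, hface, fun v hv w hw => ?_⟩
      -- In the sup metric the simplex has diameter at most 1.
      rw [pow_zero]
      exact (Metric.dist_le_diam_of_mem (bounded_stdSimplex _) (hface v hv).1
        (hface w hw).1).trans diam_stdSimplex_le
    | succ r ih =>
      obtain ⟨c, h1, h2, h3⟩ := ih
      refine ⟨fun F => subdivide (c F), by simp [h1, subdivide_one], fun F => ?_, ?_⟩
      · rw [chainBoundary_subdivide, h2, map_sum]
      · intro F m' hm'
        obtain ⟨m, hm, hmm⟩ := mem_support_subdivide hm'
        obtain ⟨hd, hf, hdist⟩ := h3 F m hm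
        obtain ⟨g1, g2, g3⟩ := mem_support_subdivide_monomial (n + 1) m
          (hd ▸ by simpa using F.card_le_univ) hdist m' hmm
        refine ⟨g1.trans hd, fun v hv => ?_, fun v hv w hw => ?_⟩
        · exact convexHull_min (fun x hx => hf x hx) (convex_simplexFace F) (g2 v hv)
        · rw [pow_succ']; exact g3 v hv w hw
  obtain ⟨r, hr⟩ := exists_pow_lt_of_lt_one hε hκ1
  obtain ⟨c, h1, h2, h3⟩ := step r
  exact ⟨c, h1, h2, fun F m hm => ⟨(h3 F m hm).1, (h3 F m hm).2.1,
    fun v hv w hw => ((h3 F m hm).2.2 v hv w hw).trans hr.le⟩⟩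

end FineChains

/-! ### Potentials on the lattice of finite sets. -/

section Potential

variable {ι M : Type*} [DecidableEq ι] [AddCommGroup M]

/-- The sum of `e` along a chosen maximal chain of subsets of `F`. -/
noncomputable def chainPotential (e : ι → Finset ι → M) (F : Finset ι) : M :=
  open Classical in
  if h : F.Nonempty then chainPotential e (F.erase h.choose) + e h.choose F else 0
termination_by F.card
decreasing_by exact Finset.card_erase_lt_of_mem h.choose_spec

theorem chainPotential_empty (e : ι → Finset ι → M) : chainPotential e ∅ = 0 := by
  rw [chainPotential]; simp

/-- If `e` is closed around all squares in the lattice of finite sets, then it is the differential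
of `chainPotential e`. -/
theorem chainPotential_eq (e : ι → Finset ι → M)
    (he : ∀ (F : Finset ι) (a b : ι), a ∈ F → b ∈ F → a ≠ b →
      e a F + e b (F.erase a) = e b F + e a (F.erase b)) :
    ∀ (F : Finset ι) (a : ι), a ∈ F →
      chainPotential e F = chainPotential e (F.erase a) + e a F := by
  suffices h : ∀ (d : ℕ) (F : Finset ι), F.card = d → ∀ a ∈ F,
      chainPotential e F = chainPotential e (F.erase a) + e a F from fun F a ha => h _ F rfl a ha
  intro d
  induction d with
  | zero =>
    intro F hF a ha
    simp [Finset.card_eq_zero.1 hF] at ha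
  | succ d ih =>
    intro F hF a ha
    have hne : F.Nonempty := ⟨a, ha⟩
    obtain ⟨b, hb, hbF⟩ : ∃ b ∈ F, chainPotential e F = chainPotential e (F.erase b) + e b F :=
      ⟨hne.choose, hne.choose_spec, by rw [chainPotential, dif_pos hne]⟩
    rcases eq_or_ne a b with rfl | hab
    · exact hbF
    -- Descending through `b` then `a`, or `a` then `b`, ends at the same set, and `he` equates the
    -- two sums.
    · rw [hbF, ih (F.erase b) (by rw [Finset.card_erase_of_mem hb]; omega) a
          (Finset.mem_erase.2 ⟨hab, ha⟩),
        ih (F.erase a) (by rw [Finset.card_erase_of_mem ha]; omega) b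
          (Finset.mem_erase.2 ⟨hab.symm, hb⟩), Finset.erase_right_comm]
      have := he F a b ha hb hab
      rw [add_assoc, add_assoc, add_comm (e a (F.erase b)), ← this, add_comm (e a F)]

/-- A function on sets that is invariant under exchanges is constant on sets of given size. -/
theorem eq_of_exchange {α : Type*} (f : Finset ι → α) (r : ℕ)
    (hf : ∀ (G : Finset ι) (a b : ι), G.card = r + 1 → a ∈ G → b ∈ G → a ≠ b →
      f (G.erase a) = f (G.erase b))
    (F F' : Finset ι) (hF : F.card = r) (hF' : F'.card = r) : f F = f F' := by
  obtain ⟨d, hd⟩ : ∃ d, (F \ F').card = d := ⟨_, rfl⟩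
  induction d generalizing F with
  | zero =>
    rw [Finset.eq_of_subset_of_card_le (Finset.sdiff_eq_empty_iff_subset.1
      (Finset.card_eq_zero.1 hd)) (by omega)]
  | succ d ih =>
    have hd' : (F' \ F).card = d + 1 := by
      rw [← hd]; exact Finset.card_sdiff_comm (hF'.trans hF.symm)
    obtain ⟨a, ha⟩ := Finset.card_pos.1 (by omega : 0 < (F \ F').card)
    obtain ⟨b, hb⟩ := Finset.card_pos.1 (by omega : 0 < (F' \ F).card)
    rw [Finset.mem_sdiff] at ha hb
    have hab : a ≠ b := fun h => hb.2 (h ▸ ha.1)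
    have h1 := hf (insert b F) b a (by rw [Finset.card_insert_of_notMem hb.2, hF])
      (Finset.mem_insert_self _ _) (Finset.mem_insert_of_mem ha.1) hab.symm
    rw [Finset.erase_insert hb.2] at h1
    rw [h1]
    refine ih _ ?_ ?_
    · rw [Finset.card_erase_of_mem (Finset.mem_insert_of_mem ha.1),
        Finset.card_insert_of_notMem hb.2]
      omega
    · have : (insert b F).erase a \ F' = (F \ F').erase a := by
        ext x
        simp only [Finset.mem_sdiff, Finset.mem_erase, Finset.mem_insert]
        constructor
        · rintro ⟨⟨h1, rfl | h2⟩, h3⟩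
          · exact absurd hb.1 h3
          · exact ⟨h1, h2, h3⟩
        · rintro ⟨h1, h2, h3⟩
          exact ⟨⟨h1, Or.inr h2⟩, h3⟩
      rw [this, Finset.card_erase_of_mem (Finset.mem_sdiff.2 ha)]
      omega

end Potential

/-! ### The mod 2 count of labels. -/

section Labels

open MvPolynomial

variable {ι J : Type*}

/-- The simplex spanned by the labels `Sum.inl a`, `a ∈ F`. -/
noncomputable def inlSimplex (J : Type*) (F : Finset ι) : ι ⊕ J →₀ ℕ :=
  ∑ a ∈ F, Finsupp.single (Sum.inl a) 1

theorem inlSimplex_inl [DecidableEq ι] (F : Finset ι) (a : ι) :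
    inlSimplex J F (Sum.inl a) = if a ∈ F then 1 else 0 := by
  classical
  simp [inlSimplex, Finsupp.finsetSum_apply, Finsupp.single_apply]

theorem inlSimplex_inr (F : Finset ι) (j : J) : inlSimplex J F (Sum.inr j) = 0 := by
  simp [inlSimplex, Finsupp.finsetSum_apply]

variable [DecidableEq ι]

theorem inlSimplex_erase_add {F : Finset ι} {a : ι} (ha : a ∈ F) :
    inlSimplex J (F.erase a) + Finsupp.single (Sum.inl a) 1 = inlSimplex J F :=
  Finset.sum_erase_add _ _ ha

/-- A compatible family of mod 2 chains on the faces of a simplex, with labels in the vertex set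
`ι` and in a set `J`, such that a vertex of the chain over `F` is labelled by `J` or by `F`, and
every simplex has at most `k` labels in `ι` and at most one label in `J`. -/
structure IsLabelledChain (k : ℕ) (w : Finset ι → MvPolynomial (ι ⊕ J) (ZMod 2)) : Prop where
  empty : w ∅ = 1
  boundary : ∀ F, chainBoundary _ (w F) = ∑ a ∈ F, w (F.erase a)
  mem_of_inl : ∀ F, ∀ m ∈ (w F).support, ∀ a, m (Sum.inl a) ≠ 0 → a ∈ F
  inr_unique : ∀ F, ∀ m ∈ (w F).support, ∀ i j,
    m (Sum.inr i) ≠ 0 → m (Sum.inr j) ≠ 0 → i = j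
  card_inl_le : ∀ F, ∀ m ∈ (w F).support, ∀ A : Finset ι,
    (∀ a ∈ A, m (Sum.inl a) ≠ 0) → A.card ≤ k

namespace IsLabelledChain

variable {k : ℕ} {w : Finset ι → MvPolynomial (ι ⊕ J) (ZMod 2)}

theorem coeff_eq_zero_of_notMem (hw : IsLabelledChain k w) {F : Finset ι} {m : ι ⊕ J →₀ ℕ} {a : ι}
    (ha : a ∉ F) (hm : m (Sum.inl a) ≠ 0) : coeff m (w F) = 0 := by
  by_contra h
  exact ha (hw.mem_of_inl F m (mem_support_iff.2 h) a hm)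

theorem coeff_eq_zero_of_card (hw : IsLabelledChain k w) {F A : Finset ι} {m : ι ⊕ J →₀ ℕ}
    (hA : k < A.card) (hm : ∀ a ∈ A, m (Sum.inl a) ≠ 0) : coeff m (w F) = 0 := by
  by_contra h
  exact hA.not_ge (hw.card_inl_le F m (mem_support_iff.2 h) A hm)

theorem support_subset (hw : IsLabelledChain k w) {J₀ : Finset J}
    (hJ₀ : ∀ F, ∀ m ∈ (w F).support, ∀ j, m (Sum.inr j) ≠ 0 → j ∈ J₀) (F : Finset ι) :
    ∀ m ∈ (w F).support, m.support ⊆ F.disjSum J₀ := by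
  rintro m hm (a | j) hx
  · exact Finset.inl_mem_disjSum.2 (hw.mem_of_inl F m hm a (Finsupp.mem_support_iff.1 hx))
  · exact Finset.inr_mem_disjSum.2 (hJ₀ F m hm j (Finsupp.mem_support_iff.1 hx))

/-- Reads off the coefficient of `inlSimplex J (F.erase a)` in `boundary F`. Adding a label already
present gives the factor `1 + 1 = 0`, and for `b ≠ a` the label `b` cannot occur over `F.erase b`.
-/
theorem coeff_inlSimplex_add (hw : IsLabelledChain k w) {J₀ : Finset J}
    (hJ₀ : ∀ F, ∀ m ∈ (w F).support, ∀ j, m (Sum.inr j) ≠ 0 → j ∈ J₀)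
    {F : Finset ι} {a : ι} (ha : a ∈ F) :
    coeff (inlSimplex J F) (w F) +
        ∑ j ∈ J₀, coeff (inlSimplex J (F.erase a) + Finsupp.single (Sum.inr j) 1) (w F) =
      coeff (inlSimplex J (F.erase a)) (w (F.erase a)) := by
  have h := coeff_chainBoundary (w F) _ (hw.support_subset hJ₀ F) (inlSimplex J (F.erase a))
  rw [hw.boundary, coeff_sum, Finset.sum_disjSum, Finset.sum_eq_single_of_mem a ha,
    Finset.sum_eq_single_of_mem (s := F) a ha] at h
  · rw [h, inlSimplex_erase_add ha]
    simp [inlSimplex_inl, inlSimplex_inr]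
  · intro b hb hba
    rw [inlSimplex_inl, if_pos (Finset.mem_erase.2 ⟨hba, hb⟩), Nat.cast_one,
      CharTwo.add_self_eq_zero, mul_zero]
  · intro b hb hba
    exact hw.coeff_eq_zero_of_notMem (Finset.notMem_erase b F)
      (by simp [inlSimplex_inl, hba, hb])

/-- The same comparison for `F` without `a` and `b`, joined with `j`. A second label from `J`
contributes nothing: another one is excluded by `inr_unique`, and a repeated `j` has factor `1 + 1 =
0`. -/
theorem coeff_square (hw : IsLabelledChain k w) {J₀ : Finset J}
    (hJ₀ : ∀ F, ∀ m ∈ (w F).support, ∀ j, m (Sum.inr j) ≠ 0 → j ∈ J₀) (j : J)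
    {F : Finset ι} {a b : ι} (ha : a ∈ F) (hb : b ∈ F) (hab : a ≠ b) :
    coeff (inlSimplex J (F.erase a) + Finsupp.single (Sum.inr j) 1) (w F) +
      coeff (inlSimplex J ((F.erase a).erase b) + Finsupp.single (Sum.inr j) 1) (w (F.erase a)) =
    coeff (inlSimplex J (F.erase b) + Finsupp.single (Sum.inr j) 1) (w F) +
      coeff (inlSimplex J ((F.erase b).erase a) + Finsupp.single (Sum.inr j) 1)
        (w (F.erase b)) := by
  classical
  have hT : ∀ c ∈ F, c ≠ a ∧ c ≠ b → c ∈ (F.erase a).erase b := fun c hc h =>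
    Finset.mem_erase.2 ⟨h.2, Finset.mem_erase.2 ⟨h.1, hc⟩⟩
  have h := coeff_chainBoundary (w F) _ (hw.support_subset hJ₀ F)
    (inlSimplex J ((F.erase a).erase b) + Finsupp.single (Sum.inr j) 1)
  rw [hw.boundary, coeff_sum, Finset.sum_disjSum,
    Finset.sum_eq_add_of_mem a b ha hb hab, Finset.sum_eq_add_of_mem (s := F) a b ha hb hab,
    Finset.sum_eq_zero (s := J₀)] at h
  · rw [add_right_comm _ _ (Finsupp.single (Sum.inl b) 1),
      inlSimplex_erase_add (Finset.mem_erase.2 ⟨hab.symm, hb⟩),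
      add_right_comm _ _ (Finsupp.single (Sum.inl a) 1), Finset.erase_right_comm (a := a),
      inlSimplex_erase_add (Finset.mem_erase.2 ⟨hab, ha⟩)] at h
    simp only [Finsupp.add_apply, inlSimplex_inl] at h
    simp at h
    rw [Finset.erase_right_comm (a := a) (b := b), ← sub_eq_zero]
    rw [← sub_eq_zero] at h
    simp only [CharTwo.sub_eq_add] at h ⊢
    rw [← h]
    abel
  · intro i hi
    rcases eq_or_ne i j with rfl | hij
    · simp [inlSimplex_inr, CharTwo.add_self_eq_zero]
    · have : coeff (inlSimplex J ((F.erase a).erase b) + Finsupp.single (Sum.inr j) 1 +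
          Finsupp.single (Sum.inr i) 1) (w F) = 0 := by
        by_contra h
        exact hij (hw.inr_unique F _ (mem_support_iff.2 h) i j (by simp) (by simp))
      rw [this, zero_mul]
  · intro c hc hcab
    simp [inlSimplex_inl, hcab, hc, CharTwo.add_self_eq_zero]
  · intro c hc hcab
    exact hw.coeff_eq_zero_of_notMem (Finset.notMem_erase c F)
      (by simp [inlSimplex_inl, hcab, hc])

/-- Some label in `J` occurs over every face with `k + 1` vertices. -/
theorem exists_label [Fintype ι] (hw : IsLabelledChain k w) (hk : k + 1 ≤ Fintype.card ι) :
    ∃ j, ∀ F : Finset ι, F.card = k + 1 →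
      ∃ F' ⊆ F, ∃ m ∈ (w F').support, m (Sum.inr j) ≠ 0 := by
  classical
  set J₀ : Finset J :=
    Finset.univ.biUnion fun F => (w F).support.biUnion fun m => m.support.toRight with hJ₀def
  have hJ₀ : ∀ F, ∀ m ∈ (w F).support, ∀ j, m (Sum.inr j) ≠ 0 → j ∈ J₀ := by
    intro F m hm j hj
    simp only [hJ₀def, Finset.mem_biUnion]
    exact ⟨F, Finset.mem_univ _, m, hm, by simpa using hj⟩
  set e : J → ι → Finset ι → ZMod 2 := fun j a F =>
    coeff (inlSimplex J (F.erase a) + Finsupp.single (Sum.inr j) 1) (w F) with he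
  have hD : ∀ j, ∀ (F : Finset ι) (a : ι), a ∈ F →
      chainPotential (e j) F = chainPotential (e j) (F.erase a) + e j a F := fun j =>
    chainPotential_eq (e j) fun F a b ha hb hab => hw.coeff_square hJ₀ j ha hb hab
  have hconst : ∀ j, ∀ F F' : Finset ι, F.card = k + 1 → F'.card = k + 1 →
      chainPotential (e j) F = chainPotential (e j) F' := by
    intro j
    refine eq_of_exchange _ _ fun G a b hG ha hb hab => ?_
    -- Here `G` has `k + 2` elements, so `G.erase c` already exceeds the allowed `k` vertex labels.
    have hz : ∀ c ∈ G, e j c G = 0 := by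
      intro c hc
      refine hw.coeff_eq_zero_of_card (A := G.erase c) ?_ ?_
      · rw [Finset.card_erase_of_mem hc]; omega
      · intro x hx; simp [inlSimplex_inl, (Finset.mem_erase.1 hx).1, (Finset.mem_erase.1 hx).2]
    have h1 := hD j G a ha
    have h2 := hD j G b hb
    rw [hz a ha, add_zero] at h1
    rw [hz b hb, add_zero] at h2
    rw [← h1, h2]
  have hsum : ∀ F : Finset ι,
      ∑ j ∈ J₀, chainPotential (e j) F = coeff (inlSimplex J F) (w F) + 1 := by
    intro F
    induction F using Finset.induction_on with
    | empty =>
      simp only [chainPotential_empty, Finset.sum_const_zero, hw.empty]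
      simp [inlSimplex, CharTwo.add_self_eq_zero]
    | insert a F ha ih =>
      have h := hw.coeff_inlSimplex_add hJ₀ (Finset.mem_insert_self a F)
      rw [Finset.sum_congr rfl fun j _ => hD j _ a (Finset.mem_insert_self a F),
        Finset.sum_add_distrib]
      simp only [he, Finset.erase_insert ha] at h ih ⊢
      rw [ih, ← h]
      linear_combination CharTwo.add_self_eq_zero
        (∑ j ∈ J₀, coeff (inlSimplex J F + Finsupp.single (Sum.inr j) 1) (w (insert a F)))
  obtain ⟨F₀, -, hF₀⟩ := Finset.exists_subset_card_eq (s := (Finset.univ : Finset ι)) hk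
  have h1 : ∑ j ∈ J₀, chainPotential (e j) F₀ ≠ 0 := by
    rw [hsum, hw.coeff_eq_zero_of_card (A := F₀) (by omega)
      (fun a ha => by simp [inlSimplex_inl, ha]), zero_add]
    exact one_ne_zero
  obtain ⟨j, -, hj⟩ := Finset.exists_ne_zero_of_sum_ne_zero h1
  -- The potential vanishes at `∅`, so a nonzero value forces a nonzero `e j` on the way down, that
  -- is, a simplex with label `j`.
  have hocc : ∀ F : Finset ι, chainPotential (e j) F ≠ 0 →
      ∃ F' ⊆ F, ∃ m ∈ (w F').support, m (Sum.inr j) ≠ 0 := by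
    intro F
    induction F using Finset.induction_on with
    | empty => intro h; exact absurd (chainPotential_empty _) h
    | insert a F ha ih =>
      intro h
      rw [hD j _ a (Finset.mem_insert_self a F), Finset.erase_insert ha] at h
      by_cases h2 : e j a (insert a F) = 0
      · rw [h2, add_zero] at h
        obtain ⟨F', hF', hm⟩ := ih h
        exact ⟨F', hF'.trans (Finset.subset_insert a F), hm⟩
      · exact ⟨_, subset_rfl, _, mem_support_iff.2 h2, by simp⟩
  exact ⟨j, fun F hF => hocc F (by rwa [hconst j F F₀ hF hF₀])⟩

end IsLabelledChain

end Labels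

/-! ### The labelling by components and the main theorem. -/

open MvPolynomial

theorem isClosed_simplexFace {n : ℕ} (s : Finset (Fin (n + 1))) : IsClosed (simplexFace s) := by
  have : simplexFace s = stdSimplex ℝ (Fin (n + 1)) ∩ ⋂ j ∈ {j | j ∉ s}, {x | x j = 0} := by
    ext x; simp [simplexFace]
  rw [this]
  exact (isClosed_stdSimplex ℝ _).inter (isClosed_biInter fun j _ =>
    isClosed_eq (continuous_apply j) continuous_const)

theorem simplexFace_mono {n : ℕ} {s t : Finset (Fin (n + 1))} (h : s ⊆ t) :
    simplexFace s ⊆ simplexFace t :=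
  fun _ hx => ⟨hx.1, fun j hj => hx.2 j fun hjs => hj (h hjs)⟩

/-- For finitely many closed sets there is a `δ > 0` such that the sets meeting a common
`δ`-ball centered in a given compact set have a common point. -/
theorem exists_pos_forall_ball_inter {α ι : Type*} [PseudoMetricSpace α] [Finite ι] {K : Set α}
    (hK : IsCompact K) (Z : ι → Set α) (hZ : ∀ i, IsClosed (Z i)) :
    ∃ δ > 0, ∀ y ∈ K, ∃ x, ∀ i, (Metric.ball y δ ∩ Z i).Nonempty → x ∈ Z i := by
  obtain ⟨δ, hδ, h⟩ := lebesgue_number_lemma_of_metric hK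
    (c := fun x : α => ⋂ i ∈ {i | x ∉ Z i}, (Z i)ᶜ)
    (fun x => (Set.toFinite _).isOpen_biInter fun i _ => (hZ i).isOpen_compl)
    (fun x _ => Set.mem_iUnion.2 ⟨x, Set.mem_iInter₂.2 fun i hi => hi⟩)
  refine ⟨δ, hδ, fun y hy => ?_⟩
  obtain ⟨x, hx⟩ := h y hy
  refine ⟨x, fun i ⟨z, hz, hzi⟩ => ?_⟩
  by_contra hxi
  exact Set.mem_iInter₂.1 (hx hz) i hxi hzi

theorem mainTheorem1 (n k N : ℕ) (hk : k ≤ n)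
    (X : Fin N → Set (Fin (n + 1) → ℝ))
    (hsub : ∀ i, X i ⊆ stdSimplex ℝ (Fin (n + 1)))
    (hclosed : ∀ i, IsClosed (X i))
    (hfacet : ∀ i, ∃ F, IsSimplexFacet n F ∧ X i ∩ F = ∅)
    (hinter : ∀ I : Finset (Fin N), I.card = k + 1 → ⋂ i ∈ I, X i = ∅) :
    ∃ x ∈ stdSimplex ℝ (Fin (n + 1)) \ ⋃ i, X i,
      ∀ F, IsSimplexFace n k F →
        (connectedComponentIn (stdSimplex ℝ (Fin (n + 1)) \ ⋃ i, X i) x ∩ F).Nonempty := by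
  classical
  set U := stdSimplex ℝ (Fin (n + 1)) \ ⋃ i, X i with hU
  have hfacet' : ∀ i, ∃ j, X i ∩ simplexFace {j}ᶜ = ∅ := by
    intro i
    obtain ⟨_, ⟨j, rfl⟩, h⟩ := hfacet i
    exact ⟨j, h⟩
  choose vert hvert using hfacet'
  -- The facets join the family so that an `X i` cannot come `δ`-close to the facet it misses.
  obtain ⟨δ, hδ, hball⟩ := exists_pos_forall_ball_inter (isCompact_stdSimplex ℝ (Fin (n + 1)))
    (Sum.elim X fun j => simplexFace {j}ᶜ)
    (by rintro (i | j); exacts [hclosed i, isClosed_simplexFace _])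
  -- a point is labelled by a vertex if it is near some `X i`, else by its component
  let near : (Fin (n + 1) → ℝ) → Fin N → Prop := fun y i =>
    (Metric.ball y (δ / 2) ∩ X i).Nonempty
  let label : (Fin (n + 1) → ℝ) → Fin (n + 1) ⊕ Set (Fin (n + 1) → ℝ) := fun y =>
    if h : ∃ i, near y i then Sum.inl (vert h.choose) else Sum.inr (connectedComponentIn U y)
  have label_inl : ∀ y a, label y = Sum.inl a → ∃ i, near y i ∧ vert i = a := by
    intro y a h
    by_cases hy : ∃ i, near y i
    · simp only [label, dif_pos hy, Sum.inl.injEq] at h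
      exact ⟨_, hy.choose_spec, h⟩
    · simp [label, dif_neg hy] at h
  have label_inr : ∀ y C, label y = Sum.inr C →
      (∀ i, ¬ near y i) ∧ connectedComponentIn U y = C := by
    intro y C h
    by_cases hy : ∃ i, near y i
    · simp [label, dif_pos hy] at h
    · simp only [label, dif_neg hy, Sum.inr.injEq] at h
      exact ⟨not_exists.1 hy, h⟩
  have hmemU : ∀ y ∈ stdSimplex ℝ (Fin (n + 1)), (∀ i, ¬ near y i) → y ∈ U := by
    refine fun y hy h => ⟨hy, fun hyX => ?_⟩
    obtain ⟨i, hi⟩ := Set.mem_iUnion.1 hyX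
    exact h i ⟨y, Metric.mem_ball_self (by positivity), hi⟩
  -- With mesh `δ / 4`, every set within `δ / 2` of a vertex of a simplex meets the `δ`-ball about
  -- any other vertex, and edges stay inside `δ / 2`-balls.
  obtain ⟨c, hc0, hcb, hc⟩ := exists_fine_chains n (ε := δ / 4) (by positivity)
  have hsupp : ∀ F, ∀ m ∈ (rename label (c F)).support, ∃ m' ∈ (c F).support,
      ∀ l, m l ≠ 0 → ∃ y ∈ m'.support, label y = l := by
    intro F m hm
    obtain ⟨m', rfl, hm'⟩ := coeff_rename_ne_zero _ _ _ (mem_support_iff.1 hm)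
    refine ⟨m', mem_support_iff.2 hm', fun l hl => ?_⟩
    have := Finsupp.mapDomain_support (Finsupp.mem_support_iff.2 hl)
    simpa using this
  have hw : IsLabelledChain k (fun F => rename label (c F)) := by
    refine ⟨by simp [hc0], fun F => by rw [chainBoundary_rename, hcb, map_sum], ?_, ?_, ?_⟩
    · intro F m hm a ha
      obtain ⟨m', hm', h⟩ := hsupp F m hm
      obtain ⟨y, hy, hya⟩ := h _ ha
      obtain ⟨i, ⟨z, hz, hzi⟩, rfl⟩ := label_inl y a hya
      have hyF := (hc F m' hm').2.1 y hy
      by_contra haF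
      obtain ⟨x, hx⟩ := hball y hyF.1
      have h1 : x ∈ X i := hx (Sum.inl i)
        ⟨z, Metric.ball_subset_ball (by linarith) hz, hzi⟩
      have h2 : x ∈ simplexFace {vert i}ᶜ := hx (Sum.inr (vert i))
        ⟨y, Metric.mem_ball_self hδ, simplexFace_mono (fun b hb => by
          simp only [Finset.mem_compl, Finset.mem_singleton]
          rintro rfl
          exact haF hb) hyF⟩
      exact (Set.eq_empty_iff_forall_notMem.1 (hvert i)) x ⟨h1, h2⟩
    · intro F m hm C C' hC hC'
      obtain ⟨m', hm', h⟩ := hsupp F m hm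
      obtain ⟨y, hy, hyC⟩ := h _ hC
      obtain ⟨y', hy', hyC'⟩ := h _ hC'
      obtain ⟨hny, rfl⟩ := label_inr y C hyC
      obtain ⟨hny', rfl⟩ := label_inr y' C' hyC'
      obtain ⟨-, hface, hdist⟩ := hc F m' hm'
      have hseg : segment ℝ y y' ⊆ U := by
        intro z hz
        refine ⟨(convex_stdSimplex ℝ _).segment_subset (hface y hy).1 (hface y' hy').1 hz,
          fun hzX => ?_⟩
        obtain ⟨i, hi⟩ := Set.mem_iUnion.1 hzX
        refine hny i ⟨z, ?_, hi⟩
        have hyy : y' ∈ Metric.ball y (δ / 2) :=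
          lt_of_le_of_lt (hdist y' hy' y hy) (by linarith)
        exact (convex_ball y (δ / 2)).segment_subset
          (Metric.mem_ball_self (by positivity)) hyy hz
      exact connectedComponentIn_eq ((convex_segment y y').isPreconnected.subset_connectedComponentIn
        (left_mem_segment ℝ y y') hseg (right_mem_segment ℝ y y'))
    · intro F m hm A hA
      obtain ⟨m', hm', h⟩ := hsupp F m hm
      obtain ⟨-, hface, hdist⟩ := hc F m' hm'
      rcases A.eq_empty_or_nonempty with rfl | ⟨a₀, ha₀⟩
      · simp
      obtain ⟨y₀, hy₀, -⟩ := h _ (hA a₀ ha₀)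
      obtain ⟨x, hx⟩ := hball y₀ (hface y₀ hy₀).1
      have hex : ∀ a ∈ A, ∃ i, x ∈ X i ∧ vert i = a := by
        intro a ha
        obtain ⟨y, hy, hya⟩ := h _ (hA a ha)
        obtain ⟨i, ⟨z, hz, hzi⟩, hia⟩ := label_inl y a hya
        refine ⟨i, hx (Sum.inl i) ⟨z, ?_, hzi⟩, hia⟩
        have := dist_triangle z y y₀
        have := hdist y hy y₀ hy₀
        have := Metric.mem_ball.1 hz
        exact Metric.mem_ball.2 (by linarith)
      by_contra hcard
      obtain ⟨I, hIsub, hIcard⟩ := Finset.exists_subset_card_eq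
        -- Distinct labels come from distinct indices, so `x` lies in at least `A.card` of the sets.
        (s := Finset.univ.filter fun i => x ∈ X i) (n := k + 1) (by
          refine (Nat.succ_le_of_lt (not_le.1 hcard)).trans ?_
          refine (Finset.card_le_card fun a ha => ?_).trans (Finset.card_image_le (f := vert))
          obtain ⟨i, hi, hia⟩ := hex a ha
          exact Finset.mem_image.2 ⟨i, by simpa using hi, hia⟩)
      refine (Set.eq_empty_iff_forall_notMem.1 (hinter I hIcard)) x ?_
      exact Set.mem_iInter₂.2 fun i hi => (Finset.mem_filter.1 (hIsub hi)).2
  obtain ⟨C, hC⟩ := hw.exists_label (by simpa using hk)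
  have hpt : ∀ F : Finset (Fin (n + 1)), F.card = k + 1 →
      ∃ y ∈ simplexFace F, y ∈ U ∧ connectedComponentIn U y = C := by
    intro F hF
    obtain ⟨F', hF', m, hm, hmC⟩ := hC F hF
    obtain ⟨m', hm', h⟩ := hsupp F' m hm
    obtain ⟨y, hy, hyC⟩ := h _ hmC
    obtain ⟨hny, hyC⟩ := label_inr y C hyC
    have hyF := (hc F' m' hm').2.1 y hy
    exact ⟨y, simplexFace_mono hF' hyF, hmemU y hyF.1 hny, hyC⟩
  obtain ⟨F₀, -, hF₀⟩ := Finset.exists_subset_card_eq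
    (s := (Finset.univ : Finset (Fin (n + 1)))) (n := k + 1) (by simpa using hk)
  obtain ⟨x, -, hxU, rfl⟩ := hpt F₀ hF₀
  refine ⟨x, hxU, ?_⟩
  rintro _ ⟨F, hF, rfl⟩
  obtain ⟨y, hyF, hyU, hyx⟩ := hpt F hF
  exact ⟨y, hyx ▸ mem_connectedComponentIn hyU, hyF⟩
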